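/- Let $m,n\ge 1$ be integers, and let $\boldsymbol\omega=(\boldsymbol\alpha,\boldsymbol\beta)\in\mathbb R^m\times\mathbb R^n$ be any pair of weight vectors, that is, $\alpha_i>0$ for all $i$, $\beta_j>0$ for all $j$, and $\sum_{i=1}^m\alpha_i=\sum_{j=1}^n\beta_j=1$. Put $\|\mathbf x\|_{\boldsymbol\alpha}=\max_i|x_i|^{1/\alpha_i}$ for $\mathbf x\in\mathbb R^m$ and $\|\mathbf y\|_{\boldsymbol\beta}=\max_j|y_j|^{1/\beta_j}$ for $\mathbf y\in\mathbb R^n$. For a function $\psi$ that is positive on $(0,\infty)$, let $D_{\infty,\boldsymbol\omega}(\psi)$ be the set of $(\psi,\boldsymbol\omega)$-Dirichlet matrices, that is, of those real $m\times n$ matrices $A$ such that for all sufficiently large real $t$ there exists $(\mathbf p,\mathbf q)\in\mathbb Z^m\times(\mathbb Z^n\smallsetminus\{\mathbf 0\})$ with $$\|A\mathbf q-\mathbf p\|_{\boldsymbol\alpha}<\psi(t)\quad\text{and}\quad\|\mathbf q\|_{\boldsymbol\beta}<t.$$ Let $\psi_1(t)=1/t$. Then $D_{\infty,\boldsymbol\omega}(\psi_1)$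 is the set of all real $m\times n$ matrices; that is, every real $m\times n$ matrix is $(\psi_1,\boldsymbol\omega)$-Dirichlet. -/

import Mathlib

/-- Weight vectors: all entries are positive and they sum to `1`.
In particular the index type is nonempty, so the dimension is positive. -/
def IsWeight {k : ℕ} (w : Fin k → ℝ) : Prop :=
  (∀ i, 0 < w i) ∧ ∑ i, w i = 1

/-- The quasi-norm `max_i |x_i|^{1/w_i}` attached to a weight vector `w`. The supremum of the
finite family is the maximum, since the index set is nonempty for a weight vector. -/
noncomputable def weightedQuasiNorm {k : ℕ} (w : Fin k → ℝ) (x : Fin k → ℝ) : ℝ :=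
  ⨆ i, |x i| ^ (1 / w i)

/-- The set of `(ψ, ω)`-Dirichlet `m × n` matrices for the supremum norm, `ω = (α, β)`:
for all sufficiently large real `t` there are `p ∈ ℤ^m` and `q ∈ ℤ^n` with `q ≠ 0` such that
`‖A q - p‖_α < ψ t` and `‖q‖_β < t`. -/
def dirichletSet {m n : ℕ} (α : Fin m → ℝ) (β : Fin n → ℝ) (ψ : ℝ → ℝ) :
    Set (Matrix (Fin m) (Fin n) ℝ) :=
  {A | ∀ᶠ t : ℝ in Filter.atTop, ∃ (p : Fin m → ℤ) (q : Fin n → ℤ), q ≠ 0 ∧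
    weightedQuasiNorm α (A.mulVec (fun j => (q j : ℝ)) - fun i => (p i : ℝ)) < ψ t ∧
    weightedQuasiNorm β (fun j => (q j : ℝ)) < t}

/-- The function `ψ₁(t) = 1/t`, used for positive `t` only. -/
noncomputable def psiOne (t : ℝ) : ℝ := 1 / t

/-! Minkowski's theorem makes only one of the two inequalities strict; rigidity of tilings gives
both. A rational column yields an exact solution. Otherwise some integer vector `k` makes every
entry of `kA` irrational. If a large `t` had no solution, the translates by `Aq`, with `0 ≤ q j < t
^ β j`, of the torus box with sides `(0, t ^ (-α i)]` would be disjoint. There are at least `t` of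
them, each of volume `1/t`, so they fill the torus up to a null set. Integrating the character `k`
then gives `0` as the sum of its values at the `Aq` times its integral over the box
(`sum_mFourier_mul_setIntegral_eq_zero`). Neither factor vanishes: the sum is a product of geometric
sums with irrational phases, and the box is short compared with `k`. -/

open MeasureTheory in
instance UnitAddCircle.isProbabilityMeasure_volume :
    IsProbabilityMeasure (volume : Measure UnitAddCircle) :=
  ⟨UnitAddCircle.measure_univ⟩

/-- The half-open arc `(0, a]` of the circle `ℝ / ℤ`. -/
def UnitAddCircle.arc (a : ℝ) : Set UnitAddCircle :=
  (fun s : ℝ => (s : UnitAddCircle)) '' Set.Ioc 0 a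

/-! ### Arcs of the circle and their Fourier integrals -/

namespace UnitAddCircle

open MeasureTheory

lemma preimage_arc_inter {a : ℝ} (ha : a ≤ 1) :
    (fun s : ℝ => (s : UnitAddCircle)) ⁻¹' arc a ∩ Set.Ioc 0 1 = Set.Ioc 0 a := by
  ext x
  constructor
  · rintro ⟨⟨y, hy, hyx⟩, hx⟩
    have : y = x := by
      have h0 : (y : AddCircle (1 : ℝ)) = (x : AddCircle (1 : ℝ)) := hyx
      refine (AddCircle.coe_eq_coe_iff_of_mem_Ioc (p := (1 : ℝ)) (a := 0) ?_ ?_).1 h0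
      · exact ⟨hy.1, by linarith [hy.2]⟩
      · exact ⟨hx.1, by linarith [hx.2]⟩
    exact this ▸ hy
  · intro hx
    exact ⟨⟨x, hx, rfl⟩, hx.1, hx.2.trans ha⟩

lemma measurableSet_arc {a : ℝ} (ha : a ≤ 1) : MeasurableSet (arc a) := by
  have : arc a = (AddCircle.measurableEquivIoc (1 : ℝ) 0) ⁻¹' {y | (y : ℝ) ≤ a} := by
    ext x
    constructor
    · rintro ⟨y, hy, rfl⟩
      have hy' : y ∈ Set.Ioc (0 : ℝ) (0 + 1) := ⟨hy.1, by linarith [hy.2]⟩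
      change ((AddCircle.equivIoc (1 : ℝ) 0 (y : AddCircle (1 : ℝ)) : Set.Ioc (0 : ℝ) (0 + 1)) : ℝ) ≤ a
      rw [AddCircle.equivIoc_coe_eq hy']
      exact hy.2
    · intro hx
      refine ⟨_, ⟨(AddCircle.equivIoc (1 : ℝ) 0 x).2.1, hx⟩, ?_⟩
      exact (AddCircle.equivIoc (1 : ℝ) 0).symm_apply_apply x
  rw [this]
  exact (AddCircle.measurableEquivIoc (1 : ℝ) 0).measurable
    (measurableSet_le measurable_subtype_coe measurable_const)

lemma volume_arc {a : ℝ} (ha : a ≤ 1) : volume (arc a) = ENNReal.ofReal a := by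
  have := AddCircle.add_projection_respects_measure (1 : ℝ) 0 (measurableSet_arc ha)
  rw [zero_add] at this
  refine this.trans ?_
  rw [show (QuotientAddGroup.mk ⁻¹' arc a ∩ Set.Ioc (0 : ℝ) 1) = Set.Ioc 0 a from
    preimage_arc_inter ha]
  simp

lemma setIntegral_arc {a : ℝ} (ha0 : 0 ≤ a) (ha : a ≤ 1) (f : UnitAddCircle → ℂ) :
    ∫ x in arc a, f x = ∫ s in (0 : ℝ)..a, f s := by
  have hm : MeasurableSet ((fun s : ℝ => (s : UnitAddCircle)) ⁻¹' arc a) :=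
    AddCircle.measurable_mk' (measurableSet_arc ha)
  rw [← integral_indicator (measurableSet_arc ha), ← UnitAddCircle.integral_preimage 0,
    zero_add, intervalIntegral.integral_of_le ha0, ← preimage_arc_inter ha,
    ← Measure.restrict_restrict hm, ← integral_indicator hm]
  rfl

/-- For `n ≠ 0` the integral is `(exp (2πina) - 1) / (2πin)`, which vanishes only if `na` is an
integer; `0 < |na| < 1` excludes this. -/
lemma setIntegral_arc_fourier_ne_zero {a : ℝ} (ha0 : 0 < a) (ha : a ≤ 1) {n : ℤ}
    (hn : |(n : ℝ)| * a < 1) : ∫ x in arc a, fourier n x ≠ 0 := by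
  rw [setIntegral_arc ha0.le ha]
  simp_rw [fourier_coe_apply]
  by_cases h0 : n = 0
  · simpa [h0] using ha0.ne'
  have hc : 2 * (Real.pi : ℂ) * Complex.I * n ≠ 0 := by
    simp [h0, Real.pi_ne_zero]
  simp only [Complex.ofReal_one, div_one]
  rw [integral_exp_mul_complex hc]
  refine div_ne_zero ?_ hc
  rw [Complex.ofReal_zero, mul_zero, Complex.exp_zero, sub_ne_zero, Ne, Complex.exp_eq_one_iff]
  rintro ⟨l, hl⟩
  have h1 : (n : ℂ) * a = l := by
    have : (2 * (Real.pi : ℂ) * Complex.I) ≠ 0 := by simp [Real.pi_ne_zero]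
    apply mul_left_cancel₀ this
    linear_combination hl
  have h2 : (n : ℝ) * a = l := by exact_mod_cast h1
  have h3 : |(l : ℝ)| < 1 := by rw [← h2, abs_mul, abs_of_pos ha0]; exact hn
  have h4 : l = 0 := by
    rw [← Int.abs_lt_one_iff]; exact_mod_cast h3
  rw [h4, Int.cast_zero, mul_eq_zero] at h2
  rcases h2 with h2 | h2
  · exact h0 (by exact_mod_cast h2)
  · exact ha0.ne' h2

/-- If translates by `x` and `y` of the arc `(0, a]` meet, then `x - y` is within `a` of `ℤ`. -/
lemma exists_int_abs_sub_lt_of_mem_arc {a x y : ℝ} {z : UnitAddCircle}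
    (hx : z - (x : UnitAddCircle) ∈ arc a) (hy : z - (y : UnitAddCircle) ∈ arc a) :
    ∃ p : ℤ, |x - y - p| < a := by
  obtain ⟨u, hu, hux⟩ := hx
  obtain ⟨v, hv, hvy⟩ := hy
  have h : ((x - y + (u - v) : ℝ) : AddCircle (1 : ℝ)) = 0 := by
    have h1 : (u : UnitAddCircle) = z - (x : UnitAddCircle) := hux
    have h2 : (v : UnitAddCircle) = z - (y : UnitAddCircle) := hvy
    rw [AddCircle.coe_add, AddCircle.coe_sub, AddCircle.coe_sub]
    erw [h1, h2]
    abel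
  obtain ⟨p, hp⟩ := (AddCircle.coe_eq_zero_iff (1 : ℝ)).1 h
  refine ⟨p, ?_⟩
  rw [zsmul_eq_mul, mul_one] at hp
  -- Two points of the half-open `(0, a]` differ by strictly less than `a`.
  rw [hp, abs_lt]
  constructor <;> linarith [hu.1, hu.2, hv.1, hv.2]

end UnitAddCircle

/-! ### Characters, boxes and tilings of the torus -/

namespace UnitAddTorus

open MeasureTheory

variable {d : Type*} [Fintype d]

/-- The monomial `mFourier k` as an additive character of the torus. -/
noncomputable def mFourierAddChar (k : d → ℤ) : AddChar (UnitAddTorus d) ℂ where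
  toFun := mFourier k
  map_zero_eq_one' := by simp [mFourier]
  map_add_eq_mul' x y := by
    simp [mFourier, ← Finset.prod_mul_distrib, fourier_apply, AddCircle.toCircle_add, smul_add]

lemma mFourierAddChar_apply (k : d → ℤ) (x : UnitAddTorus d) :
    mFourierAddChar k x = mFourier k x := rfl

lemma mFourier_coe (k : d → ℤ) (x : d → ℝ) :
    mFourier k (fun i => (x i : UnitAddCircle)) =
      Complex.exp (2 * Real.pi * Complex.I * ((∑ i, k i * x i : ℝ) : ℂ)) := by
  simp only [mFourier, ContinuousMap.coe_mk, fourier_coe_apply, ← Complex.exp_sum]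
  congr 1
  push_cast
  rw [Finset.mul_sum]
  exact Finset.sum_congr rfl fun i _ => by ring

lemma integral_mFourier_eq_zero {k : d → ℤ} (hk : k ≠ 0) : ∫ x, mFourier k x = 0 := by
  classical
  obtain ⟨i, hi⟩ := Function.ne_iff.1 hk
  have h := integral_fintype_prod_volume_eq_prod (𝕜 := ℂ) (E := fun _ : d => UnitAddCircle)
    (fun i x => fourier (k i) x)
  refine h.trans (Finset.prod_eq_zero (Finset.mem_univ i) ?_)
  -- A shift by half a period changes the sign of the character.
  exact integral_eq_zero_of_add_right_eq_neg (μ := (volume : Measure UnitAddCircle))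
      (fourier_add_half_inv_index hi one_pos)

/-- The box in the torus with sides the arcs `(0, a i]`. -/
def box (a : d → ℝ) : Set (UnitAddTorus d) := Set.univ.pi fun i => UnitAddCircle.arc (a i)

lemma measurableSet_box {a : d → ℝ} (ha : ∀ i, a i ≤ 1) : MeasurableSet (box a) :=
  MeasurableSet.univ_pi fun i => UnitAddCircle.measurableSet_arc (ha i)

lemma volume_box {a : d → ℝ} (ha0 : ∀ i, 0 ≤ a i) (ha : ∀ i, a i ≤ 1) :
    volume (box a) = ENNReal.ofReal (∏ i, a i) := by
  rw [box]
  erw [volume_pi_pi]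
  simp_rw [UnitAddCircle.volume_arc (ha _)]
  rw [ENNReal.ofReal_prod_of_nonneg fun i _ => ha0 i]

lemma setIntegral_box_mFourier_ne_zero {a : d → ℝ} (ha0 : ∀ i, 0 < a i) (ha : ∀ i, a i ≤ 1)
    {k : d → ℤ} (hk : ∀ i, |(k i : ℝ)| * a i < 1) : ∫ x in box a, mFourier k x ≠ 0 := by
  have h : ∫ x in box a, mFourier k x =
      ∏ i, ∫ x in UnitAddCircle.arc (a i), fourier (k i) x := by
    have h1 : (volume : Measure (d → UnitAddCircle)).restrict (box a) =
        Measure.pi fun i => (volume : Measure UnitAddCircle).restrict (UnitAddCircle.arc (a i)) := by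
      rw [volume_pi, box]
      exact Measure.restrict_pi_pi _ _
    erw [h1]
    exact integral_fintype_prod_eq_prod (𝕜 := ℂ) (E := fun _ : d => UnitAddCircle)
      (fun i x => fourier (k i) x)
  rw [h]
  exact Finset.prod_ne_zero_iff.2 fun i _ =>
    UnitAddCircle.setIntegral_arc_fourier_ne_zero (ha0 i) (ha i) (hk i)

/-- If finitely many disjoint translates of `B` have total volume at least one, then every
nontrivial monomial annihilates the sum of the translations or has integral zero over `B`. -/
lemma sum_mFourier_mul_setIntegral_eq_zero {ι : Type*} {s : Finset ι} {c : ι → UnitAddTorus d}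
    {B : Set (UnitAddTorus d)} (hB : MeasurableSet B)
    (hdisj : ∀ q ∈ s, ∀ q' ∈ s, ∀ x, x - c q ∈ B → x - c q' ∈ B → q = q')
    (hvol : 1 ≤ s.card * volume B) {k : d → ℤ} (hk : k ≠ 0) :
    (∑ q ∈ s, mFourier k (c q)) * ∫ x in B, mFourier k x = 0 := by
  have : IsProbabilityMeasure (volume : Measure (UnitAddTorus d)) :=
    inferInstanceAs (IsProbabilityMeasure (volume : Measure (d → UnitAddCircle)))
  have : Measure.IsAddHaarMeasure (volume : Measure (UnitAddTorus d)) :=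
    inferInstanceAs (Measure.IsAddHaarMeasure (volume : Measure (d → UnitAddCircle)))
  have hmp (q : ι) : MeasurePreserving (fun x : UnitAddTorus d => x - c q) :=
    measurePreserving_sub_right volume (c q)
  let S : ι → Set (UnitAddTorus d) := fun q => (fun x => x - c q) ⁻¹' B
  have hS (q : ι) : MeasurableSet (S q) := (hmp q).measurable hB
  have hpd : Set.PairwiseDisjoint (s : Set ι) S := by
    intro q hq q' hq' hne
    refine Set.disjoint_left.2 fun x hx hx' => hne (hdisj q hq q' hq' x hx hx')
  have hU : volume (⋃ q ∈ s, S q) = 1 := by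
    refine le_antisymm prob_le_one ?_
    rw [measure_biUnion_finset hpd fun q _ => hS q]
    simpa [S, (hmp _).measure_preimage hB.nullMeasurableSet] using hvol
  have hUm : MeasurableSet (⋃ q ∈ s, S q) := Finset.measurableSet_biUnion s fun q _ => hS q
  have hae : (⋃ q ∈ s, S q) =ᵐ[volume] Set.univ := by
    rw [ae_eq_univ]
    exact (prob_compl_eq_zero_iff hUm).2 hU
  have hint (T : Set (UnitAddTorus d)) : IntegrableOn (fun x => mFourier k x) T := by
    refine Integrable.integrableOn ?_
    exact (mFourier k).continuous.integrable_of_hasCompactSupport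
      (HasCompactSupport.of_compactSpace _)
  have h1 (q : ι) : ∫ x in S q, mFourier k x = mFourier k (c q) * ∫ x in B, mFourier k x := by
    have := (hmp q).setIntegral_preimage_emb (MeasurableEquiv.subRight (c q)).measurableEmbedding
      (fun y => mFourier k (y + c q)) B
    simp only [sub_add_cancel] at this
    rw [this, ← integral_const_mul]
    congr 1
    ext y
    rw [← mFourierAddChar_apply, AddChar.map_add_eq_mul, mul_comm]
    rfl
  calc (∑ q ∈ s, mFourier k (c q)) * ∫ x in B, mFourier k x
      = ∑ q ∈ s, ∫ x in S q, mFourier k x := by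
        rw [Finset.sum_mul]
        exact Finset.sum_congr rfl fun q _ => (h1 q).symm
    _ = ∫ x in ⋃ q ∈ s, S q, mFourier k x :=
        (integral_biUnion_finset s (fun q _ => hS q) hpd fun q _ => hint _).symm
    _ = ∫ x, mFourier k x := by rw [setIntegral_congr_set hae, setIntegral_univ]
    _ = 0 := integral_mFourier_eq_zero hk

end UnitAddTorus

/-! ### Irrationality and strict approximation -/

lemma weightedQuasiNorm_lt_iff {k : ℕ} {w : Fin k → ℝ} (hw : IsWeight w) (x : Fin k → ℝ) {s : ℝ}
    (hs : 0 < s) : weightedQuasiNorm w x < s ↔ ∀ i, |x i| < s ^ w i := by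
  have hne : Nonempty (Fin k) := by
    by_contra h
    have := not_nonempty_iff.1 h
    simpa using hw.2
  have h1 : weightedQuasiNorm w x < s ↔ ∀ i, |x i| ^ (1 / w i) < s := by
    rw [weightedQuasiNorm]
    refine ⟨fun h i => (le_ciSup (Set.finite_range _).bddAbove i).trans_lt h, fun h => ?_⟩
    obtain ⟨i, hi⟩ := exists_eq_ciSup_of_finite (f := fun i => |x i| ^ (1 / w i))
    exact hi ▸ h i
  rw [h1]
  refine forall_congr' fun i => ?_
  rw [one_div, Real.rpow_inv_lt_iff_of_pos (abs_nonneg _) hs.le (hw.1 i)]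

/-- A zero sum would make the ratio an `r`-th root of unity, so `rθ` would be an integer. -/
lemma geom_sum_exp_ne_zero {θ : ℝ} (hθ : Irrational θ) {r : ℕ} (hr : 0 < r) :
    ∑ l ∈ Finset.range r, Complex.exp (2 * Real.pi * Complex.I * (θ : ℂ)) ^ l ≠ 0 := by
  intro h0
  have h1 := geom_sum_mul (Complex.exp (2 * Real.pi * Complex.I * (θ : ℂ))) r
  rw [h0, zero_mul, eq_comm, sub_eq_zero, ← Complex.exp_nat_mul, Complex.exp_eq_one_iff] at h1
  obtain ⟨l, hl⟩ := h1
  have h2 : (r : ℂ) * θ = l := by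
    have : (2 * (Real.pi : ℂ) * Complex.I) ≠ 0 := by simp [Real.pi_ne_zero]
    apply mul_left_cancel₀ this
    linear_combination hl
  have h3 : (r : ℝ) * θ = l := by exact_mod_cast h2
  exact (hθ.natCast_mul hr.ne').ne_int l h3

/-- If every column of `A` has an irrational entry, then some integer combination of the rows has
only irrational entries. -/
lemma exists_int_combination_irrational {m n : ℕ} (A : Matrix (Fin m) (Fin n) ℝ)
    (hA : ∀ j, ∃ i, Irrational (A i j)) :
    ∃ k : Fin m → ℤ, ∀ j, Irrational (∑ i, k i * A i j) := by
  let φ : Fin n → (Fin m → ℚ) →ₗ[ℚ] ℝ := fun j => ∑ i, (LinearMap.proj i).smulRight (A i j)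
  have hφ (j) (v : Fin m → ℚ) : φ j v = ∑ i, v i * A i j := by
    simp [φ, Rat.smul_def]
  let K : Fin n → Subspace ℚ (Fin m → ℚ) := fun j =>
    (LinearMap.range (Algebra.linearMap ℚ ℝ)).comap (φ j)
  have hK (j) (v) : v ∈ K j ↔ ¬ Irrational (∑ i, v i * A i j) := by
    simp only [K, Submodule.mem_comap, LinearMap.mem_range, hφ, Irrational, not_not, Set.mem_range]
    rfl
  -- Finitely many proper subspaces over the infinite field `ℚ` do not cover the space.
  have hv : ∃ v, ∀ j, v ∉ K j := by
    by_contra! h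
    obtain ⟨j, hj⟩ := Subspace.exists_eq_top_of_iUnion_eq_univ (p := K)
      (Set.eq_univ_of_forall fun v => Set.mem_iUnion.2 (h v))
    obtain ⟨i, hi⟩ := hA j
    have : Pi.single i (1 : ℚ) ∈ K j := hj ▸ Submodule.mem_top
    rw [hK] at this
    apply this
    rw [Finset.sum_eq_single i (fun b _ hb => by simp [hb]) (by simp)]
    simpa using hi
  obtain ⟨v, hv⟩ := hv
  obtain ⟨D, hD⟩ := IsLocalization.exist_integer_multiples_of_finite (nonZeroDivisors ℤ) v
  choose k hk using hD
  refine ⟨k, fun j => ?_⟩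
  have h1 := not_not.1 (mt (hK j v).2 (hv j))
  have hD0 : (D : ℤ) ≠ 0 := nonZeroDivisors.coe_ne_zero D
  have h2 : ∑ i, (k i : ℝ) * A i j = (D : ℤ) * ∑ i, v i * A i j := by
    rw [Finset.mul_sum]
    refine Finset.sum_congr rfl fun i _ => ?_
    have h3 : (k i : ℚ) = (D : ℤ) * v i := by simpa using hk i
    have h4 : (k i : ℝ) = (D : ℤ) * (v i : ℝ) := by exact_mod_cast congrArg (Rat.cast (K := ℝ)) h3
    rw [h4, mul_assoc]
  rw [h2]
  exact h1.intCast_mul hD0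

/-- A strict form of Dirichlet's theorem for boxes, under an irrationality condition. -/
lemma exists_int_approx_of_irrational {m n : ℕ} (hn : 0 < n) (A : Matrix (Fin m) (Fin n) ℝ)
    {k : Fin m → ℤ} (hk : ∀ j, Irrational (∑ i, k i * A i j)) {a : Fin m → ℝ} {b : Fin n → ℝ}
    (ha0 : ∀ i, 0 < a i) (ha : ∀ i, a i ≤ 1) (hb : ∀ j, 0 < b j)
    (hab : 1 ≤ (∏ j, b j) * ∏ i, a i) (hka : ∀ i, |(k i : ℝ)| * a i < 1) :
    ∃ (p : Fin m → ℤ) (q : Fin n → ℤ), q ≠ 0 ∧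
      (∀ i, |(A.mulVec (fun j => (q j : ℝ)) - fun i => (p i : ℝ)) i| < a i) ∧
      ∀ j, |(q j : ℝ)| < b j := by
  by_contra! hcon
  have hk0 : k ≠ 0 := by
    rintro rfl
    simpa using hk ⟨0, hn⟩
  -- Exactly `⌈b j⌉₊` naturals lie below `b j`: at least `b j` of them, with differences strictly
  -- below `b j` in absolute value.
  let s : Finset (Fin n → ℕ) := Fintype.piFinset fun j => Finset.range ⌈b j⌉₊
  let col : Fin n → UnitAddTorus (Fin m) := fun j i => (A i j : UnitAddCircle)
  let c : (Fin n → ℕ) → UnitAddTorus (Fin m) := fun q => ∑ j, q j • col j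
  have hc (q) (i) : c q i = ((∑ j, A i j * q j : ℝ) : UnitAddCircle) := by
    have h1 : ((∑ j, A i j * q j : ℝ) : UnitAddCircle) =
        ∑ j, ((A i j * q j : ℝ) : UnitAddCircle) :=
      map_sum (QuotientAddGroup.mk' (AddSubgroup.zmultiples (1 : ℝ))) _ _
    rw [h1]
    refine (Finset.sum_apply i _ _).trans (Finset.sum_congr rfl fun j _ => ?_)
    change q j • (A i j : AddCircle (1 : ℝ)) = _
    rw [← AddCircle.coe_nsmul, nsmul_eq_mul, mul_comm]
  have hdisj : ∀ q ∈ s, ∀ q' ∈ s, ∀ x, x - c q ∈ UnitAddTorus.box a →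
      x - c q' ∈ UnitAddTorus.box a → q = q' := by
    intro q hq q' hq' x hx hx'
    by_contra hne
    have hp (i) : ∃ p : ℤ, |∑ j, A i j * q j - ∑ j, A i j * q' j - p| < a i := by
      refine UnitAddCircle.exists_int_abs_sub_lt_of_mem_arc (z := x i) ?_ ?_
      · rw [← hc]; exact hx i (Set.mem_univ i)
      · rw [← hc]; exact hx' i (Set.mem_univ i)
    choose p hp using hp
    obtain ⟨j, hj⟩ := hcon p (fun j => (q j : ℤ) - q' j)
      (fun h => hne (funext fun j => by have := congrFun h j; simp at this; omega))
      (fun i => by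
        convert hp i using 2
        simp [Matrix.mulVec, dotProduct, mul_sub])
    have h1 : (q j : ℝ) < b j := Nat.lt_ceil.1 (Finset.mem_range.1 (Fintype.mem_piFinset.1 hq j))
    have h2 : (q' j : ℝ) < b j := Nat.lt_ceil.1 (Finset.mem_range.1 (Fintype.mem_piFinset.1 hq' j))
    have h3 : |(((q j : ℤ) - q' j : ℤ) : ℝ)| < b j := by
      push_cast
      rw [abs_lt]
      constructor <;> linarith [(q j).cast_nonneg (α := ℝ), (q' j).cast_nonneg (α := ℝ)]
    exact absurd hj h3.not_ge
  have hvol : 1 ≤ (s.card : ENNReal) * MeasureTheory.volume (UnitAddTorus.box a) := by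
    rw [UnitAddTorus.volume_box (fun i => (ha0 i).le) ha, ← ENNReal.ofReal_natCast,
      ← ENNReal.ofReal_mul (Nat.cast_nonneg _), ← ENNReal.ofReal_one]
    refine ENNReal.ofReal_le_ofReal (hab.trans ?_)
    refine mul_le_mul_of_nonneg_right ?_ (Finset.prod_nonneg fun i _ => (ha0 i).le)
    simp only [s, Fintype.card_piFinset, Finset.card_range, Nat.cast_prod]
    exact Finset.prod_le_prod (fun j _ => (hb j).le) fun j _ => Nat.le_ceil _
  have h := UnitAddTorus.sum_mFourier_mul_setIntegral_eq_zero (UnitAddTorus.measurableSet_box ha)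
    hdisj hvol hk0
  refine mul_ne_zero ?_ (UnitAddTorus.setIntegral_box_mFourier_ne_zero ha0 ha hka) h
  have hsum : ∑ q ∈ s, UnitAddTorus.mFourier k (c q) =
      ∏ j, ∑ l ∈ Finset.range ⌈b j⌉₊, UnitAddTorus.mFourier k (col j) ^ l := by
    rw [Finset.prod_univ_sum]
    refine Finset.sum_congr rfl fun q _ => ?_
    simp only [← UnitAddTorus.mFourierAddChar_apply, ← AddChar.map_nsmul_eq_pow]
    exact map_prod (UnitAddTorus.mFourierAddChar k).toMonoidHom
      (fun j => Multiplicative.ofAdd (q j • col j)) Finset.univ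
  rw [hsum]
  refine Finset.prod_ne_zero_iff.2 fun j _ => ?_
  have hcol := UnitAddTorus.mFourier_coe k fun i => A i j
  rw [show UnitAddTorus.mFourier k (col j) = _ from hcol]
  exact geom_sum_exp_ne_zero (hk j) (Nat.ceil_pos.2 (hb j))

/-- A matrix with a rational column sends a nonzero integer vector to an integer vector. -/
lemma exists_mulVec_eq_int_of_rational_column {m n : ℕ} (A : Matrix (Fin m) (Fin n) ℝ) {j : Fin n}
    (hj : ∀ i, ¬ Irrational (A i j)) :
    ∃ (p : Fin m → ℤ) (q : Fin n → ℤ), q ≠ 0 ∧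
      A.mulVec (fun j => (q j : ℝ)) = fun i => (p i : ℝ) := by
  have hr (i) : ∃ r : ℚ, (r : ℝ) = A i j := not_not.1 (hj i)
  choose r hr using hr
  obtain ⟨D, hD⟩ := IsLocalization.exist_integer_multiples_of_finite (nonZeroDivisors ℤ) r
  choose p hp using hD
  refine ⟨p, Pi.single j (D : ℤ), ?_, ?_⟩
  · simp
  · ext i
    have h3 : (p i : ℚ) = (D : ℤ) * r i := by simpa using hp i
    have h4 : (p i : ℝ) = (D : ℤ) * (r i : ℝ) := by exact_mod_cast congrArg (Rat.cast (K := ℝ)) h3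
    rw [h4, hr, Matrix.mulVec, dotProduct, Finset.sum_eq_single j
      (fun b _ hb => by simp [hb]) (by simp), Pi.single_eq_same, mul_comm]

theorem mainTheorem5 (m n : ℕ) (α : Fin m → ℝ) (β : Fin n → ℝ)
    (hα : IsWeight α) (hβ : IsWeight β) :
    dirichletSet α β psiOne = (Set.univ : Set (Matrix (Fin m) (Fin n) ℝ)) := by
  refine Set.eq_univ_of_forall fun A => ?_
  have hlarge {k : ℕ} {w : Fin k → ℝ} (hw : IsWeight w) (x : Fin k → ℤ) :
      ∀ᶠ t : ℝ in Filter.atTop, ∀ i, |(x i : ℝ)| < t ^ w i :=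
    Filter.eventually_all.2 fun i =>
      (tendsto_rpow_atTop (hw.1 i)).eventually_gt_atTop _
  change ∀ᶠ t : ℝ in Filter.atTop, _
  by_cases hA : ∃ j, ∀ i, ¬ Irrational (A i j)
  -- Here one exact solution, independent of `t`, serves all large `t`.
  · obtain ⟨j, hj⟩ := hA
    obtain ⟨p, q, hq, hpq⟩ := exists_mulVec_eq_int_of_rational_column A hj
    filter_upwards [hlarge hβ q, Filter.eventually_gt_atTop 0] with t ht ht0
    refine ⟨p, q, hq, ?_, (weightedQuasiNorm_lt_iff hβ _ ht0).2 ht⟩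
    have hψ : 0 < psiOne t := one_div_pos.2 ht0
    rw [hpq, sub_self, weightedQuasiNorm_lt_iff hα _ hψ]
    intro i
    simpa using Real.rpow_pos_of_pos hψ (α i)
  · push Not at hA
    obtain ⟨k, hk⟩ := exists_int_combination_irrational A hA
    have hn : 0 < n := by
      rcases Nat.eq_zero_or_pos n with rfl | h
      · simpa using hβ.2
      · exact h
    -- As `k` depends only on `A`, large `t` gives `|k i| < t ^ α i`, the shortness condition on the
    -- box.
    filter_upwards [hlarge hα k, Filter.eventually_ge_atTop 1] with t ht ht1
    have ht0 : 0 < t := one_pos.trans_le ht1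
    have hψ : 0 < psiOne t := one_div_pos.2 ht0
    have hψe (i) : psiOne t ^ α i = (t ^ α i)⁻¹ := by
      rw [psiOne, one_div, Real.inv_rpow ht0.le]
    obtain ⟨p, q, hq, hp, hqb⟩ := exists_int_approx_of_irrational hn A hk
      (a := fun i => psiOne t ^ α i) (b := fun j => t ^ β j)
      (fun i => Real.rpow_pos_of_pos hψ _)
      (fun i => by
        rw [hψe]
        exact inv_le_one_of_one_le₀ (Real.one_le_rpow ht1 (hα.1 i).le))
      (fun j => Real.rpow_pos_of_pos ht0 _)
      (by
        rw [← Real.rpow_sum_of_pos ht0, ← Real.rpow_sum_of_pos hψ, hα.2, hβ.2, Real.rpow_one,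
          Real.rpow_one, psiOne, mul_one_div_cancel ht0.ne'])
      (fun i => by
        rw [hψe, ← div_eq_mul_inv, div_lt_one (Real.rpow_pos_of_pos ht0 _)]
        exact ht i)
    exact ⟨p, q, hq, (weightedQuasiNorm_lt_iff hα _ hψ).2 hp,
      (weightedQuasiNorm_lt_iff hβ _ ht0).2 hqb⟩
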